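/- Let $T>0$, let $\beta,\gamma\in\mathbb R$, and let $k,g$ be real functions on the circle $S^1$ of length $T$ with $kg\in L^2(S^1)$. Write $\oint$ for integration over the circle with respect to arc length $d\tau$. Consider in the complex Hilbert space $L^2(S^1)$ the operator $$Qf=-\beta f''+\gamma\oint k\,g\,f$$ (the last term is a constant function), with domain $H^2(S^1)$, the functions in $L^2(S^1)$ whose weak second derivative is in $L^2(S^1)$. Assume that $Q$ is nondegenerate, that is, $\beta\neq0$ and $\gamma\oint kg\neq0$. Put $\lambda_0=\gamma\oint kg$ and $\lambda_n=\beta\,(2\pi n/T)^2$ for $n\in\mathbb Z\setminus\{0\}$. Then the spectrum of $Q$ is $\{\lambda_n : n\in\mathbb Z\}$, every $z\in\mathbb C$ has algebraic multiplicity $\#\{n\in\mathbb Z:\lambda_n=z\}$ (the dimension of $\bigcup_j\ker(Q-z)^j$), and the zeta-regularized determinant of $Q$ exists and equals $$\operatorname{Det}Q=\frac{\gamma}{\beta}\,T^2\oint kg .$$ Here the zeta-regularized determinant of an invertible operator whose spectrum is discrete (eigenvalues of finite algebraic multiplicity without finite accumulation point) is $\exp(-\zeta'(0))$, where $\zeta$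 is the meromorphic continuation to $\mathbb C$, required to be analytic at $0$, of $\zeta(s)=\sum_\lambda\lambda^{-s}$ (for $\operatorname{Re}s$ large, with absolute convergence), the sum being over the eigenvalues counted with algebraic multiplicity and $\lambda^{-s}=e^{-s\operatorname{Log}\lambda}$ with $-\pi<\operatorname{Im}\operatorname{Log}\lambda\le\pi$. -/

import Mathlib

open MeasureTheory Set

noncomputable section

namespace UnboundedOperator

/-! ### Spectral notions for an unbounded operator -/

variable {H : Type*} [NormedAddCommGroup H] [NormedSpace ℂ H]

/-- `z` is in the resolvent set of the (unbounded) operator `A` if `A - z`, as a map from the domain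
of `A` to the whole space, has a bounded everywhere defined two-sided inverse `R`. -/
def IsResolventPoint (A : H →ₗ.[ℂ] H) (z : ℂ) : Prop :=
  ∃ R : H →L[ℂ] H,
    (∀ u : H, ∃ hu : R u ∈ A.domain, A ⟨R u, hu⟩ - z • R u = u) ∧
    (∀ x : A.domain, R (A x - z • (x : H)) = x)

/-- The spectrum of an unbounded operator: the complement of the resolvent set. -/
def spec (A : H →ₗ.[ℂ] H) : Set ℂ := {z | ¬ IsResolventPoint A z}

/-- `kerPow A z n` is the kernel of `(A - z) ^ n` on its natural domain. -/
def kerPow (A : H →ₗ.[ℂ] H) (z : ℂ) : ℕ → Submodule ℂ H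
  | 0 => ⊥
  | n + 1 => ((kerPow A z n).comap (A.toFun - z • A.domain.subtype)).map A.domain.subtype

/-- The root space (generalized eigenspace) `⋃ₙ ker (A - z) ^ n`. -/
def rootSpace (A : H →ₗ.[ℂ] H) (z : ℂ) : Submodule ℂ H := ⨆ n, kerPow A z n

/-- The algebraic multiplicity of `z` as an eigenvalue of `A`. -/
def algMult (A : H →ₗ.[ℂ] H) (z : ℂ) : ℕ := Module.finrank ℂ (rootSpace A z)

/-- `A` has discrete spectrum: every spectral point is an eigenvalue of finite algebraic
multiplicity, and the spectrum has no finite accumulation point. -/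
structure HasDiscreteSpectrum (A : H →ₗ.[ℂ] H) : Prop where
  isEigenvalue : ∀ z ∈ spec A, ∃ x : A.domain, (x : H) ≠ 0 ∧ A x = z • (x : H)
  finiteDimensional : ∀ z ∈ spec A, FiniteDimensional ℂ (rootSpace A z)
  finite_inter_closedBall : ∀ r : ℝ, (spec A ∩ Metric.closedBall 0 r).Finite

/-- `Z` is the spectral zeta function of `A`: on some right half-plane it is the absolutely
convergent sum of `λ ^ (-s)` over the eigenvalues `λ` of `A` counted with algebraic multiplicity,
and it is meromorphic on `ℂ`. Here `λ ^ (-s) = exp (-s Log λ)` with `-π < Im Log λ ≤ π`. -/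
structure IsSpectralZeta (A : H →ₗ.[ℂ] H) (Z : ℂ → ℂ) : Prop where
  hasSum : ∃ σ : ℝ, ∀ s : ℂ, σ < s.re →
    HasSum (fun z : spec A => (algMult A z : ℂ) * (z : ℂ) ^ (-s)) (Z s)
  meromorphic : MeromorphicOn Z univ

/-- `d` is the zeta-regularized determinant of `A`: the operator `A` has discrete spectrum and is
invertible, its spectral zeta function `Z` continues analytically to `0`, and
`d = exp (-Z'(0))`. -/
def IsZetaDet (A : H →ₗ.[ℂ] H) (d : ℂ) : Prop :=
  HasDiscreteSpectrum A ∧ (0 : ℂ) ∉ spec A ∧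
    ∃ Z : ℂ → ℂ, IsSpectralZeta A Z ∧ AnalyticAt ℂ Z 0 ∧ d = Complex.exp (-deriv Z 0)

/-- The zeta-regularized determinant is unique. -/
theorem IsZetaDet.unique {A : H →ₗ.[ℂ] H} {d₁ d₂ : ℂ} (h₁ : IsZetaDet A d₁)
    (h₂ : IsZetaDet A d₂) : d₁ = d₂ := by
  obtain ⟨-, -, Z, ⟨⟨a, ha⟩, mZ⟩, aZ, rfl⟩ := h₁
  obtain ⟨-, -, W, ⟨⟨b, hb⟩, mW⟩, aW, rfl⟩ := h₂
  have mF : MeromorphicOn (Z - W) univ := mZ.sub mW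
  have hF : meromorphicOrderAt (Z - W) ((max a b + 1 : ℝ) : ℂ) = ⊤ := by
    rw [meromorphicOrderAt_eq_top_iff]
    apply Filter.Eventually.filter_mono nhdsWithin_le_nhds
    have ho : IsOpen {s : ℂ | max a b < s.re} := isOpen_lt continuous_const Complex.continuous_re
    filter_upwards [ho.mem_nhds (show max a b < ((max a b + 1 : ℝ) : ℂ).re by
      rw [Complex.ofReal_re]; linarith)] with s hs
    have h1 := ha s (lt_of_le_of_lt (le_max_left _ _) hs)
    have h2 := hb s (lt_of_le_of_lt (le_max_right _ _) hs)
    simp [h1.unique h2]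
  have h0 : meromorphicOrderAt (Z - W) 0 = ⊤ := by
    by_contra h
    exact mF.meromorphicOrderAt_ne_top_of_isPreconnected isPreconnected_univ (mem_univ _)
      (mem_univ _) h hF
  rw [meromorphicOrderAt_eq_top_iff] at h0
  have h3 : ∀ᶠ s in nhds (0 : ℂ), (Z - W) s = 0 :=
    ((aZ.sub aW).frequently_zero_iff_eventually_zero).1 h0.frequently
  have h4 : Z =ᶠ[nhds 0] W := by
    filter_upwards [h3] with s hs
    exact sub_eq_zero.1 hs
  rw [h4.deriv_eq]

end UnboundedOperator

namespace FaddeevPopov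

/-! ### The Faddeev–Popov operator on the circle of length `T` -/

variable (T : ℝ) [hT : Fact (0 < T)]

/-- The (complexified) space `L²(S¹)` of the circle of length `T`, with the arc-length measure. -/
abbrev L2 : Type := Lp ℂ 2 (volume : Measure (AddCircle T))

variable {T}

/-- `h` is the second derivative of `f` in the weak sense: `∮ f φ'' = ∮ h φ` for every smooth
`T`-periodic test function `φ`. -/
def IsWeakSecondDeriv (f h : L2 T) : Prop :=
  ∀ φ : ℝ → ℂ, ContDiff ℝ (⊤ : ℕ∞) φ → Function.Periodic φ T →
    ∫ τ in (0 : ℝ)..T, f (τ : AddCircle T) * iteratedDeriv 2 φ τ =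
      ∫ τ in (0 : ℝ)..T, h (τ : AddCircle T) * φ τ


theorem intervalIntegrable_mul (f : L2 T) {ψ : ℝ → ℂ} (hψ : Continuous ψ) :
    IntervalIntegrable (fun τ : ℝ => f (τ : AddCircle T) * ψ τ) volume 0 T := by
  have h1 : Integrable (f : AddCircle T → ℂ) volume := (Lp.memLp f).integrable (by norm_num)
  have h2 := (AddCircle.measurePreserving_mk T 0).integrable_comp_of_integrable h1
  rw [zero_add] at h2
  have h3 : IntervalIntegrable (fun τ : ℝ => f (τ : AddCircle T)) volume 0 T := by
    rw [intervalIntegrable_iff_integrableOn_Ioc_of_le hT.out.le]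
    exact h2
  exact h3.mul_continuousOn hψ.continuousOn

theorem intervalIntegral_congr_ae {u v : AddCircle T → ℂ} (huv : u =ᵐ[volume] v) (ψ : ℝ → ℂ) :
    ∫ τ in (0 : ℝ)..T, u (τ : AddCircle T) * ψ τ =
      ∫ τ in (0 : ℝ)..T, v (τ : AddCircle T) * ψ τ := by
  rw [intervalIntegral.integral_of_le hT.out.le, intervalIntegral.integral_of_le hT.out.le]
  apply integral_congr_ae
  have h2 := (AddCircle.measurePreserving_mk T 0).quasiMeasurePreserving.ae_eq huv
  rw [zero_add] at h2
  filter_upwards [h2] with τ hτ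
  simp only [Function.comp_apply] at hτ
  rw [hτ]

theorem intervalIntegral_add (f g : L2 T) {ψ : ℝ → ℂ} (hψ : Continuous ψ) :
    ∫ τ in (0 : ℝ)..T, (f + g : L2 T) (τ : AddCircle T) * ψ τ =
      (∫ τ in (0 : ℝ)..T, f (τ : AddCircle T) * ψ τ) +
        ∫ τ in (0 : ℝ)..T, g (τ : AddCircle T) * ψ τ := by
  rw [intervalIntegral_congr_ae (Lp.coeFn_add f g),
    ← intervalIntegral.integral_add (intervalIntegrable_mul f hψ) (intervalIntegrable_mul g hψ)]
  simp only [Pi.add_apply, add_mul]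

theorem intervalIntegral_smul (c : ℂ) (f : L2 T) (ψ : ℝ → ℂ) :
    ∫ τ in (0 : ℝ)..T, (c • f : L2 T) (τ : AddCircle T) * ψ τ =
      c * ∫ τ in (0 : ℝ)..T, f (τ : AddCircle T) * ψ τ := by
  rw [intervalIntegral_congr_ae (Lp.coeFn_smul c f), ← intervalIntegral.integral_const_mul]
  simp only [Pi.smul_apply, smul_eq_mul, mul_assoc]

theorem IsWeakSecondDeriv.add {f₁ h₁ f₂ h₂ : L2 T} (H₁ : IsWeakSecondDeriv f₁ h₁)
    (H₂ : IsWeakSecondDeriv f₂ h₂) : IsWeakSecondDeriv (f₁ + f₂) (h₁ + h₂) := by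
  intro φ hφ hp
  have hc : Continuous (iteratedDeriv 2 φ) :=
    (contDiff_infty.1 hφ 2).continuous_iteratedDeriv 2 le_rfl
  rw [intervalIntegral_add _ _ hc, intervalIntegral_add _ _ hφ.continuous, H₁ φ hφ hp, H₂ φ hφ hp]

theorem IsWeakSecondDeriv.smul (c : ℂ) {f h : L2 T} (H : IsWeakSecondDeriv f h) :
    IsWeakSecondDeriv (c • f) (c • h) := by
  intro φ hφ hp
  rw [intervalIntegral_smul, intervalIntegral_smul, H φ hφ hp]

/-- A function in `L²(S¹)` that is orthogonal to all smooth periodic functions vanishes. -/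
theorem eq_zero_of_forall_intervalIntegral (h : L2 T)
    (H : ∀ φ : ℝ → ℂ, ContDiff ℝ (⊤ : ℕ∞) φ → Function.Periodic φ T →
      ∫ τ in (0 : ℝ)..T, h (τ : AddCircle T) * φ τ = 0) : h = 0 := by
  have hm : MemLp (h : AddCircle T → ℂ) 2 AddCircle.haarAddCircle :=
    memLp_haarAddCircle_iff.2 (Lp.memLp h)
  have key : hm.toLp h = 0 := by
    apply fourierBasis.repr.injective
    rw [map_zero]
    ext n
    rw [fourierBasis_repr, fourierCoeff_congr_ae hm.coeFn_toLp, fourierCoeff_eq_intervalIntegral _ n 0,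
      zero_add]
    have h1 := H (fun τ : ℝ => fourier (-n) (τ : AddCircle T)) (by
        have ho : ContDiff ℝ (⊤ : ℕ∞) (fun τ : ℝ => (τ : ℂ)) := Complex.ofRealCLM.contDiff
        simp only [fourier_coe_apply]
        exact ((contDiff_const.mul ho).div_const _).cexp) (fun τ => by
        simp only [AddCircle.coe_add_period])
    simp only [smul_eq_mul, mul_comm _ (h _), h1]
    simp
  have h2 : (h : AddCircle T → ℂ) =ᵐ[AddCircle.haarAddCircle] 0 := by
    have := hm.coeFn_toLp
    rw [key] at this
    exact this.symm.trans (Lp.coeFn_zero _ _ _)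
  rw [Lp.eq_zero_iff_ae_eq_zero]
  exact Measure.ae_smul_measure h2 (ENNReal.ofReal T)

theorem IsWeakSecondDeriv.unique {f h₁ h₂ : L2 T} (H₁ : IsWeakSecondDeriv f h₁)
    (H₂ : IsWeakSecondDeriv f h₂) : h₁ = h₂ := by
  have H := H₁.add (H₂.smul (-1))
  rw [neg_one_smul, neg_one_smul, add_neg_cancel, ← sub_eq_add_neg] at H
  refine sub_eq_zero.1 (eq_zero_of_forall_intervalIntegral _ fun φ hφ hp => ?_)
  rw [← H φ hφ hp, ← zero_smul ℂ (0 : L2 T), intervalIntegral_smul, zero_mul]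

variable (T) in
/-- The operator `d²/dτ²` in `L²(S¹)` on its natural domain `H²(S¹)`, the space of all `f ∈ L²(S¹)`
with a weak second derivative in `L²(S¹)`. -/
def secondDeriv : L2 T →ₗ.[ℂ] L2 T where
  domain :=
    { carrier := {f | ∃ h, IsWeakSecondDeriv f h}
      add_mem' := fun ⟨h₁, H₁⟩ ⟨h₂, H₂⟩ => ⟨h₁ + h₂, H₁.add H₂⟩
      zero_mem' := ⟨0, fun φ _ _ => by
        rw [← zero_smul ℂ (0 : L2 T), intervalIntegral_smul, intervalIntegral_smul, zero_mul,
          zero_mul]⟩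
      smul_mem' := fun c _ ⟨h, H⟩ => ⟨c • h, H.smul c⟩ }
  toFun :=
    { toFun := fun f => f.2.choose
      map_add' := fun f g =>
        (f + g).2.choose_spec.unique (f.2.choose_spec.add g.2.choose_spec)
      map_smul' := fun c f => (c • f).2.choose_spec.unique (f.2.choose_spec.smul c) }

theorem secondDeriv_spec (f : (secondDeriv T).domain) :
    IsWeakSecondDeriv (f : L2 T) (secondDeriv T f) := f.2.choose_spec

/-- The bounded operator `f ↦ (γ ∮ k g f) · 1` on `L²(S¹)`, for real functions `k`, `g` on the
circle whose product is square integrable. -/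
def nonlocalTerm (γ : ℝ) (k g : AddCircle T → ℝ) (hkg : MemLp (fun τ => k τ * g τ) 2 volume) :
    L2 T →ₗ[ℂ] L2 T where
  toFun f := Lp.const 2 volume ((γ : ℂ) * ∫ τ, (k τ : ℂ) * g τ * f τ)
  map_add' f₁ f₂ := by
    have hw : MemLp (fun τ => (k τ : ℂ) * g τ) 2 (volume : Measure (AddCircle T)) := by
      simpa using hkg.ofReal (K := ℂ)
    have h₁ : Integrable (fun τ => (k τ : ℂ) * g τ * f₁ τ) volume := hw.integrable_mul (Lp.memLp f₁)
    have h₂ : Integrable (fun τ => (k τ : ℂ) * g τ * f₂ τ) volume := hw.integrable_mul (Lp.memLp f₂)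
    rw [← map_add, ← mul_add, ← integral_add h₁ h₂]
    congr 2
    apply integral_congr_ae
    filter_upwards [Lp.coeFn_add f₁ f₂] with τ hτ
    rw [hτ, Pi.add_apply, mul_add]
  map_smul' c f := by
    have : ∫ τ, (k τ : ℂ) * g τ * (c • f : L2 T) τ = c * ∫ τ, (k τ : ℂ) * g τ * f τ := by
      rw [← integral_const_mul]
      apply integral_congr_ae
      filter_upwards [Lp.coeFn_smul c f] with τ hτ
      rw [hτ, Pi.smul_apply, smul_eq_mul]
      ring
    rw [this, RingHom.id_apply, mul_left_comm]
    exact (Lp.constL 2 (volume : Measure (AddCircle T)) ℂ).map_smul c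
      ((γ : ℂ) * ∫ τ, (k τ : ℂ) * g τ * f τ)

/-- The Faddeev–Popov operator `Q f = -β f'' + γ ∮ k g f` in `L²(S¹)`, with domain `H²(S¹)`. -/
def faddeevPopov (β γ : ℝ) (k g : AddCircle T → ℝ)
    (hkg : MemLp (fun τ => k τ * g τ) 2 volume) : L2 T →ₗ.[ℂ] L2 T where
  domain := (secondDeriv T).domain
  toFun := -(β : ℂ) • (secondDeriv T).toFun +
    (nonlocalTerm γ k g hkg) ∘ₗ (secondDeriv T).domain.subtype

/-- The numbers `λ₀ = γ ∮ k g` and `λₙ = β (2πn/T)²` for integers `n ≠ 0`. -/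
def eigenvalue (T β γ : ℝ) [Fact (0 < T)] (k g : AddCircle T → ℝ) (n : ℤ) : ℝ :=
  if n = 0 then γ * (∫ τ, k τ * g τ) else β * (2 * Real.pi * n / T) ^ 2

end FaddeevPopov

end

noncomputable section

/-! ### Kernels of powers and diagonal operators in a Hilbert basis -/

namespace UnboundedOperator

variable {H : Type*} [NormedAddCommGroup H]

/-! In the Fourier basis `-β d²/dτ²` is diagonal, and the nonlocal term maps into the constants. So
`Q` is diagonal with entries `β (2πn/T)²` except for its zeroth row, which is a bounded functional
`w` whose value at the normalized constant is `λ₀` (`isTriangular_faddeevPopov`).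

Such an operator (`IsTriangular`) has the spectrum and the multiplicities of its diagonal. The
resolvent comes from back substitution (`isResolventPoint`), and a root space is determined by its
coordinates at the indices carrying the given diagonal value (`rootSpaceEquiv`), even if a Jordan
block occurs because `λ₀` equals some other `λₙ`.

Summing over the diagonal, the spectral zeta function is `λ₀^(-s) + 2 c^(-s) ζ(2s)` with `c = β
(2π/T)²` (`hasSum_circleZeta`). The values `ζ(0) = -1/2` and `ζ'(0) = -log(2π)/2` turn `exp(-Z'(0))`
into `(λ₀/c) (2π)² = λ₀ T²/β`. -/

theorem mem_kerPow_succ [NormedSpace ℂ H] {A : H →ₗ.[ℂ] H} {z : ℂ} {n : ℕ} {x : H} :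
    x ∈ kerPow A z (n + 1) ↔ ∃ y, (x, y) ∈ A.graph ∧ y - z • x ∈ kerPow A z n := by
  constructor
  · rintro ⟨u, hu, rfl⟩
    exact ⟨A u, A.mem_graph u, hu⟩
  · rintro ⟨y, hy, hk⟩
    obtain ⟨u, rfl, rfl⟩ := A.mem_graph_iff.1 hy
    exact ⟨u, hk, rfl⟩

theorem kerPow_mono [NormedSpace ℂ H] (A : H →ₗ.[ℂ] H) (z : ℂ) : Monotone (kerPow A z) := by
  refine monotone_nat_of_le_succ fun n => ?_
  induction n with
  | zero => exact bot_le
  | succ n ih =>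
    intro x hx
    obtain ⟨y, hy, hk⟩ := mem_kerPow_succ.1 hx
    exact mem_kerPow_succ.2 ⟨y, hy, ih hk⟩

theorem mem_rootSpace [NormedSpace ℂ H] {A : H →ₗ.[ℂ] H} {z : ℂ} {x : H} :
    x ∈ rootSpace A z ↔ ∃ n, x ∈ kerPow A z n :=
  Submodule.mem_iSup_of_directed _ (kerPow_mono A z).directed_le

theorem mem_spec_of_eigenvector [NormedSpace ℂ H] {A : H →ₗ.[ℂ] H} {z : ℂ} (x : A.domain)
    (hx : (x : H) ≠ 0) (hA : A x = z • (x : H)) : z ∈ spec A := by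
  rintro ⟨R, -, hR⟩
  have h := hR x
  rw [hA, sub_self, map_zero] at h
  exact hx h.symm

variable [InnerProductSpace ℂ H] {ι : Type*}

theorem norm_mul_apply_le {d : ι → ℂ} {C : ℝ} (hd : ∀ i, ‖d i‖ ≤ C) (hC : 0 ≤ C)
    (x : lp (fun _ : ι => ℂ) 2) (i : ι) : ‖d i * x i‖ ≤ ‖((C : ℂ) • x) i‖ := by
  rw [lp.coeFn_smul, Pi.smul_apply, norm_mul, norm_smul, Complex.norm_real,
    Real.norm_of_nonneg hC]
  exact mul_le_mul_of_nonneg_right (hd i) (norm_nonneg _)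

/-- Multiplication of a square summable family by a bounded family. -/
def lpMul (d : ι → ℂ) {C : ℝ} (hd : ∀ i, ‖d i‖ ≤ C) (hC : 0 ≤ C)
    (x : lp (fun _ : ι => ℂ) 2) : lp (fun _ : ι => ℂ) 2 :=
  ⟨fun i => d i * x i, (lp.memℓp ((C : ℂ) • x)).mono' (norm_mul_apply_le hd hC x)⟩

theorem lpMul_apply {d : ι → ℂ} {C : ℝ} (hd : ∀ i, ‖d i‖ ≤ C) (hC : 0 ≤ C)
    (x : lp (fun _ : ι => ℂ) 2) (i : ι) : lpMul d hd hC x i = d i * x i := rfl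

theorem norm_lpMul_le {d : ι → ℂ} {C : ℝ} (hd : ∀ i, ‖d i‖ ≤ C) (hC : 0 ≤ C)
    (x : lp (fun _ : ι => ℂ) 2) : ‖lpMul d hd hC x‖ ≤ C * ‖x‖ := by
  have h : ‖lpMul d hd hC x‖ ≤ ‖(C : ℂ) • x‖ :=
    lp.norm_mono two_ne_zero (norm_mul_apply_le hd hC x)
  rwa [norm_smul, Complex.norm_real, Real.norm_of_nonneg hC] at h

/-- Multiplication of square summable families by a bounded family, as a bounded operator. -/
def lpDiagonal (d : ι → ℂ) {C : ℝ} (hd : ∀ i, ‖d i‖ ≤ C) (hC : 0 ≤ C) :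
    lp (fun _ : ι => ℂ) 2 →L[ℂ] lp (fun _ : ι => ℂ) 2 :=
  LinearMap.mkContinuous
    { toFun := lpMul d hd hC
      map_add' := fun x y => by
        ext i
        simp only [lpMul_apply, lp.coeFn_add, Pi.add_apply, mul_add]
      map_smul' := fun c x => by
        ext i
        simp only [lpMul_apply, lp.coeFn_smul, Pi.smul_apply, smul_eq_mul, RingHom.id_apply,
          mul_left_comm] }
    C (norm_lpMul_le hd hC)

/-- There is a bounded operator that multiplies the coordinates in a Hilbert basis by a given
bounded family. -/
theorem exists_diagonal (b : HilbertBasis ι ℂ H) {d : ι → ℂ} {C : ℝ} (hd : ∀ i, ‖d i‖ ≤ C)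
    (hC : 0 ≤ C) : ∃ D : H →L[ℂ] H, ∀ x i, b.repr (D x) i = d i * b.repr x i := by
  let E : H ≃L[ℂ] lp (fun _ : ι => ℂ) 2 := b.repr.toContinuousLinearEquiv
  refine ⟨(E.symm : lp (fun _ : ι => ℂ) 2 →L[ℂ] H) ∘L lpDiagonal d hd hC ∘L
    (E : H →L[ℂ] lp (fun _ : ι => ℂ) 2), fun x i => ?_⟩
  change b.repr (b.repr.symm (lpDiagonal d hd hC (b.repr x))) i = _
  rw [LinearIsometryEquiv.apply_symm_apply]
  rfl

theorem repr_add (b : HilbertBasis ι ℂ H) (x y : H) (i : ι) :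
    b.repr (x + y) i = b.repr x i + b.repr y i := by
  rw [map_add, lp.coeFn_add, Pi.add_apply]

theorem repr_sub (b : HilbertBasis ι ℂ H) (x y : H) (i : ι) :
    b.repr (x - y) i = b.repr x i - b.repr y i := by
  rw [map_sub, lp.coeFn_sub, Pi.sub_apply]

theorem repr_smul (b : HilbertBasis ι ℂ H) (c : ℂ) (x : H) (i : ι) :
    b.repr (c • x) i = c * b.repr x i := by
  rw [map_smul, lp.coeFn_smul, Pi.smul_apply, smul_eq_mul]

theorem repr_basis [DecidableEq ι] (b : HilbertBasis ι ℂ H) (i j : ι) :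
    b.repr (b i) j = if j = i then 1 else 0 := by
  rw [b.repr_self, lp.single_apply]
  by_cases h : j = i
  · subst h; simp
  · simp [h]

/-! ### Spectral theory of triangular operators -/

/-- In the coordinates of the Hilbert basis `b`, the operator `A` is the maximal diagonal operator
with entries `l`, except that its coordinate at `i₀` is the bounded functional `w`. -/
structure IsTriangular (A : H →ₗ.[ℂ] H) (b : HilbertBasis ι ℂ H) (i₀ : ι) (l : ι → ℂ)
    (w : H →L[ℂ] ℂ) : Prop where
  mem_graph_iff : ∀ x y, (x, y) ∈ A.graph ↔
    (∀ i, i ≠ i₀ → b.repr y i = l i * b.repr x i) ∧ b.repr y i₀ = w x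
  apply_basis : w (b i₀) = l i₀

namespace IsTriangular

variable {A : H →ₗ.[ℂ] H} {b : HilbertBasis ι ℂ H} {i₀ : ι} {l : ι → ℂ} {w : H →L[ℂ] ℂ}

theorem basis_ext {x y : H} (h : ∀ i, b.repr x i = b.repr y i) : x = y :=
  b.repr.injective (lp.ext (funext h))

theorem eq_smul_basis {x : H} (h : ∀ i, i ≠ i₀ → b.repr x i = 0) : x = b.repr x i₀ • b i₀ := by
  classical
  refine basis_ext (b := b) fun i => ?_
  rw [repr_smul, repr_basis]
  by_cases hi : i = i₀
  · subst hi; simp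
  · simp [hi, h i hi]

/-- Back substitution: the coordinates off `i₀` are divided by `l i - z`, and the equation at `i₀`
then determines the remaining coordinate. Boundedness holds because `‖l i‖` tends to infinity. -/
theorem isResolventPoint (hA : IsTriangular A b i₀ l w)
    (hl : Filter.Tendsto (fun i => ‖l i‖) Filter.cofinite Filter.atTop) {z : ℂ} (hz : z ∉ range l) : IsResolventPoint A z := by
  classical
  have hz' (i : ι) : l i - z ≠ 0 := fun h => hz ⟨i, sub_eq_zero.1 h⟩
  let d : ι → ℂ := fun i => if i = i₀ then 0 else (l i - z)⁻¹
  obtain ⟨C, hC, hC₀⟩ : ∃ C, (∀ i, ‖d i‖ ≤ C) ∧ 0 ≤ C := by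
    have hf : {i | ‖l i‖ ≤ ‖z‖ + 1}.Finite := by
      have := hl.eventually_gt_atTop (‖z‖ + 1)
      simpa [Filter.eventually_cofinite] using this
    obtain ⟨C, hC⟩ := (hf.image fun i => ‖d i‖).bddAbove
    refine ⟨max C 1, fun i => ?_, zero_le_one.trans (le_max_right _ _)⟩
    by_cases hi : ‖l i‖ ≤ ‖z‖ + 1
    · exact (hC ⟨i, hi, rfl⟩).trans (le_max_left _ _)
    · refine le_trans ?_ (le_max_right _ _)
      simp only [d]
      split_ifs
      · simp
      · rw [norm_inv]
        -- Outside the finite exceptional set, `‖l i - z‖` exceeds 1.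
        have := norm_sub_norm_le (l i) z
        exact inv_le_one_of_one_le₀ (by linarith)
  obtain ⟨D, hD⟩ := exists_diagonal b hC hC₀
  have hD₀ (x : H) : b.repr (D x) i₀ = 0 := by rw [hD]; simp [d]
  have hD₁ (x : H) (i : ι) (hi : i ≠ i₀) : b.repr (D x) i = (l i - z)⁻¹ * b.repr x i := by
    rw [hD]; simp [d, hi]
  -- This solves `w (D u) + φ * l i₀ - z * φ = u i₀`, the equation for the coordinate at `i₀`.
  let φ : H →L[ℂ] ℂ := (l i₀ - z)⁻¹ • (innerSL ℂ (b i₀) - w ∘L D)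
  have hφ (x : H) : φ x = (l i₀ - z)⁻¹ * (b.repr x i₀ - w (D x)) := by
    simp [φ, b.repr_apply_apply]
  let R : H →L[ℂ] H := D + φ.smulRight (b i₀)
  have hR (x : H) : R x = D x + φ x • b i₀ := rfl
  have hR₁ (x : H) (i : ι) (hi : i ≠ i₀) : b.repr (R x) i = (l i - z)⁻¹ * b.repr x i := by
    rw [hR, repr_add, repr_smul, repr_basis, hD₁ x i hi]
    simp [hi]
  have hR₀ (x : H) : b.repr (R x) i₀ = φ x := by
    rw [hR, repr_add, repr_smul, repr_basis, hD₀]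
    simp
  refine ⟨R, fun u => ?_, fun x => ?_⟩
  · have hg : (R u, u + z • R u) ∈ A.graph := by
      refine (hA.mem_graph_iff _ _).2 ⟨fun i hi => ?_, ?_⟩
      · rw [repr_add, repr_smul, hR₁ u i hi]
        have := hz' i
        field_simp
        ring
      · rw [repr_add, repr_smul, hR₀, hR, map_add, map_smul, hA.apply_basis, smul_eq_mul, hφ]
        have := hz' i₀
        field_simp
        ring
    obtain ⟨x, hx, hy⟩ := A.mem_graph_iff.1 hg
    have hx' : (x : H) = R u := hx
    have hu : R u ∈ A.domain := hx' ▸ x.2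
    refine ⟨hu, ?_⟩
    have : (⟨R u, hu⟩ : A.domain) = x := Subtype.ext hx'.symm
    rw [this, hy, add_sub_cancel_right]
  · obtain ⟨h₁, h₀⟩ := (hA.mem_graph_iff _ _).1 (A.mem_graph x)
    have hDx : D (A x - z • (x : H)) = x - b.repr x i₀ • b i₀ := by
      refine basis_ext (b := b) fun i => ?_
      rw [repr_sub, repr_smul, repr_basis]
      by_cases hi : i = i₀
      · subst hi; rw [hD₀]; simp
      · rw [hD₁ _ i hi, repr_sub, repr_smul, h₁ i hi]
        have := hz' i
        simp [hi]
        field_simp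
    rw [hR, hφ, hDx, repr_sub, repr_smul, map_sub w, map_smul w, h₀, hA.apply_basis, smul_eq_mul]
    have : (l i₀ - z)⁻¹ * (w x - z * b.repr x i₀ - (w x - b.repr x i₀ * l i₀)) = b.repr x i₀ := by
      have := hz' i₀
      field_simp
      ring
    rw [this, sub_add_cancel]

theorem smul_basis_mem_graph (hA : IsTriangular A b i₀ l w) (c : ℂ) :
    (c • b i₀, (l i₀ * c) • b i₀) ∈ A.graph := by
  classical
  refine (hA.mem_graph_iff _ _).2 ⟨fun i hi => ?_, ?_⟩
  · simp [repr_basis, hi]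
  · rw [repr_smul, map_smul, hA.apply_basis, repr_basis]
    simp [mul_comm]

/-- The span of `b i` and `b i₀` is invariant; the free coefficient `c` serves to cancel the leak `w
(b i)` into `b i₀`. -/
theorem basis_add_mem_graph (hA : IsTriangular A b i₀ l w) {i : ι} (hi : i ≠ i₀) (c : ℂ) :
    (b i + c • b i₀, l i • b i + (w (b i) + l i₀ * c) • b i₀) ∈ A.graph := by
  classical
  refine (hA.mem_graph_iff _ _).2 ⟨fun j hj => ?_, ?_⟩
  · simp only [repr_add, repr_smul, repr_basis, hj, if_false, mul_zero, add_zero]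
    by_cases h : j = i <;> simp [h]
  · rw [repr_add, repr_smul, repr_smul, repr_basis, repr_basis, if_neg hi.symm, if_pos rfl, map_add,
      map_smul, hA.apply_basis, smul_eq_mul]
    ring

/-- Off `i₀`, `A - z` multiplies the coordinate by the nonzero number `l i - z`, so no power of it
can kill a nonzero coordinate. -/
theorem repr_eq_zero_of_mem_kerPow (hA : IsTriangular A b i₀ l w) {z : ℂ} {n : ℕ} {i : ι}
    (hi : i ≠ i₀) (hz : l i ≠ z) {x : H} (hx : x ∈ kerPow A z n) : b.repr x i = 0 := by
  induction n generalizing x with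
  | zero =>
    rw [(Submodule.mem_bot ℂ).1 hx]
    simp
  | succ n ih =>
    obtain ⟨y, hy, hk⟩ := mem_kerPow_succ.1 hx
    have h := ih hk
    rw [repr_sub, repr_smul, ((hA.mem_graph_iff _ _).1 hy).1 i hi, ← sub_mul] at h
    exact (mul_eq_zero.1 h).resolve_left (sub_ne_zero.2 hz)

theorem smul_basis_eq_zero_of_mem_kerPow (hA : IsTriangular A b i₀ l w) {z : ℂ} {n : ℕ}
    (hz : l i₀ ≠ z) {c : ℂ} (hx : c • b i₀ ∈ kerPow A z n) : c = 0 := by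
  induction n generalizing c with
  | zero =>
    have h := (Submodule.mem_bot ℂ).1 hx
    exact (smul_eq_zero.1 h).resolve_right (b.orthonormal.ne_zero i₀)
  | succ n ih =>
    obtain ⟨y, hy, hk⟩ := mem_kerPow_succ.1 hx
    rw [A.mem_graph_snd_inj hy (hA.smul_basis_mem_graph c) rfl, smul_smul, ← sub_smul,
      ← sub_mul] at hk
    exact (mul_eq_zero.1 (ih hk)).resolve_left (sub_ne_zero.2 hz)

/-- The coordinates at the indices with `l i = z`, as a map on the root space of `z`. -/
def rootSpaceCoord (A : H →ₗ.[ℂ] H) (b : HilbertBasis ι ℂ H) (l : ι → ℂ) (z : ℂ) :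
    rootSpace A z →ₗ[ℂ] ({i | l i = z} → ℂ) where
  toFun x i := b.repr (x : H) i
  map_add' x y := by ext i; simp
  map_smul' c x := by ext i; simp

/-- If the recorded coordinates vanish, all others off `i₀` do too, which leaves a multiple of `b
i₀`. On that line `A` is the scalar `l i₀`. -/
theorem rootSpaceCoord_injective (hA : IsTriangular A b i₀ l w) (z : ℂ) :
    Function.Injective (rootSpaceCoord A b l z) := by
  rw [← LinearMap.ker_eq_bot, LinearMap.ker_eq_bot']
  intro x hx
  obtain ⟨n, hn⟩ := mem_rootSpace.1 x.2
  have h (i : ι) (hi : l i = z) : b.repr (x : H) i = 0 := congrFun hx ⟨i, hi⟩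
  have h' (i : ι) (hi : i ≠ i₀) : b.repr (x : H) i = 0 := by
    by_cases hz : l i = z
    · exact h i hz
    · exact hA.repr_eq_zero_of_mem_kerPow hi hz hn
  have hx := eq_smul_basis h'
  have h₀ : b.repr (x : H) i₀ = 0 := by
    by_cases hz : l i₀ = z
    · exact h i₀ hz
    · exact hA.smul_basis_eq_zero_of_mem_kerPow hz (hx ▸ hn)
  rw [h₀, zero_smul] at hx
  exact Subtype.ext hx

/-- If `l i₀ = l i` with `i ≠ i₀`, then `A - l i` sends `b i` into the line of `b i₀`, which it
kills, so two powers suffice. Otherwise `c` corrects `b i` to an eigenvector. The clause on `c`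
ensures that the correction is invisible in the coordinates with diagonal value `l i`. -/
theorem exists_mem_rootSpace (hA : IsTriangular A b i₀ l w) (i : ι) :
    ∃ c : ℂ, (l i₀ = l i → c = 0) ∧ b i + c • b i₀ ∈ rootSpace A (l i) := by
  have h₀ : b i₀ ∈ kerPow A (l i₀) 1 := mem_kerPow_succ.2 ⟨l i₀ • b i₀, by
    simpa using hA.smul_basis_mem_graph 1, by rw [sub_self]; exact zero_mem _⟩
  by_cases hi : i = i₀
  · subst hi
    exact ⟨0, fun _ => rfl, mem_rootSpace.2 ⟨1, by simpa using h₀⟩⟩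
  by_cases hl : l i₀ = l i
  · refine ⟨0, fun _ => rfl, mem_rootSpace.2 ⟨2, ?_⟩⟩
    refine mem_kerPow_succ.2 ⟨_, hA.basis_add_mem_graph hi 0, ?_⟩
    rw [zero_smul, add_zero, mul_zero, add_zero, add_sub_cancel_left, ← hl]
    exact Submodule.smul_mem _ _ h₀
  · refine ⟨w (b i) / (l i - l i₀), fun h => absurd h hl,
      mem_rootSpace.2 ⟨1, mem_kerPow_succ.2 ⟨_, hA.basis_add_mem_graph hi _, ?_⟩⟩⟩
    have : w (b i) + l i₀ * (w (b i) / (l i - l i₀)) = l i * (w (b i) / (l i - l i₀)) := by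
      have := sub_ne_zero.2 (Ne.symm hl)
      field_simp
      ring
    rw [this, smul_add, smul_smul, sub_self]
    exact zero_mem _

theorem rootSpaceCoord_surjective (hA : IsTriangular A b i₀ l w) {z : ℂ}
    (hf : {i | l i = z}.Finite) : Function.Surjective (rootSpaceCoord A b l z) := by
  classical
  have := hf.fintype
  rw [← LinearMap.range_eq_top, eq_top_iff, ← (Pi.basisFun ℂ {i | l i = z}).span_eq,
    Submodule.span_le]
  rintro _ ⟨⟨i, hi⟩, rfl⟩
  have hi' : l i = z := hi
  subst hi'
  obtain ⟨c, hc, hm⟩ := hA.exists_mem_rootSpace i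
  refine ⟨⟨_, hm⟩, funext fun ⟨j, hj⟩ => ?_⟩
  have hj' : l j = l i := hj
  change b.repr (b i + c • b i₀) j = Pi.basisFun ℂ {j | l j = l i} ⟨i, hi⟩ ⟨j, hj⟩
  rw [Pi.basisFun_apply, repr_add, repr_smul, repr_basis, repr_basis, Pi.single_apply]
  by_cases h₀ : j = i₀
  · subst h₀
    simp [hc hj', Subtype.ext_iff]
  · simp [h₀, Subtype.ext_iff]

/-- The root space of `z` has the dimension `#{i | l i = z}`. -/
def rootSpaceEquiv (hA : IsTriangular A b i₀ l w) {z : ℂ} (hf : {i | l i = z}.Finite) :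
    rootSpace A z ≃ₗ[ℂ] ({i | l i = z} → ℂ) :=
  LinearEquiv.ofBijective _ ⟨hA.rootSpaceCoord_injective z, hA.rootSpaceCoord_surjective hf⟩

theorem algMult_eq (hA : IsTriangular A b i₀ l w) {z : ℂ} (hf : {i | l i = z}.Finite) :
    algMult A z = {i | l i = z}.ncard := by
  have := hf.fintype
  rw [algMult, (hA.rootSpaceEquiv hf).finrank_eq, Module.finrank_fintype_fun_eq_card,
    ← Nat.card_eq_fintype_card, Nat.card_coe_set_eq]

theorem finiteDimensional_rootSpace (hA : IsTriangular A b i₀ l w) {z : ℂ}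
    (hf : {i | l i = z}.Finite) : FiniteDimensional ℂ (rootSpace A z) :=
  have := hf.fintype
  (hA.rootSpaceEquiv hf).symm.finiteDimensional

theorem exists_eigenvector (hA : IsTriangular A b i₀ l w) (i : ι) :
    ∃ x : A.domain, (x : H) ≠ 0 ∧ A x = l i • (x : H) := by
  classical
  suffices ∃ x, x ≠ 0 ∧ (x, l i • x) ∈ A.graph by
    obtain ⟨x, hx, hg⟩ := this
    obtain ⟨u, rfl, hu⟩ := A.mem_graph_iff.1 hg
    exact ⟨u, hx, hu⟩
  by_cases hl : l i₀ = l i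
  · refine ⟨b i₀, b.orthonormal.ne_zero i₀, ?_⟩
    simpa [hl] using hA.smul_basis_mem_graph 1
  · have hi : i ≠ i₀ := fun h => hl (h ▸ rfl)
    refine ⟨b i + (w (b i) / (l i - l i₀)) • b i₀, fun h => ?_, ?_⟩
    · have := congrArg (fun x => b.repr x i) h
      simp only [repr_add, repr_smul, repr_basis] at this
      simp [hi] at this
    · have h := hA.basis_add_mem_graph hi (w (b i) / (l i - l i₀))
      have e : w (b i) + l i₀ * (w (b i) / (l i - l i₀)) = l i * (w (b i) / (l i - l i₀)) := by
        have := sub_ne_zero.2 (Ne.symm hl)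
        field_simp
        ring
      rwa [e, ← smul_smul, ← smul_add] at h

theorem spec_eq (hA : IsTriangular A b i₀ l w)
    (hl : Filter.Tendsto (fun i => ‖l i‖) Filter.cofinite Filter.atTop) : spec A = range l := by
  refine Subset.antisymm (fun z hz => ?_) ?_
  · by_contra h
    exact hz (hA.isResolventPoint hl h)
  · rintro _ ⟨i, rfl⟩
    obtain ⟨x, hx, hAx⟩ := hA.exists_eigenvector i
    exact mem_spec_of_eigenvector x hx hAx

theorem finite_norm_le (hl : Filter.Tendsto (fun i => ‖l i‖) Filter.cofinite Filter.atTop) (r : ℝ) :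
    {i | ‖l i‖ ≤ r}.Finite := by
  simpa [Filter.eventually_cofinite] using hl.eventually_gt_atTop r

theorem finite_fiber (hl : Filter.Tendsto (fun i => ‖l i‖) Filter.cofinite Filter.atTop) (z : ℂ) :
    {i | l i = z}.Finite :=
  (finite_norm_le hl ‖z‖).subset fun i (hi : l i = z) => by simp [hi]

theorem hasDiscreteSpectrum (hA : IsTriangular A b i₀ l w)
    (hl : Filter.Tendsto (fun i => ‖l i‖) Filter.cofinite Filter.atTop) :
    HasDiscreteSpectrum A where
  isEigenvalue z hz := by
    rw [hA.spec_eq hl] at hz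
    obtain ⟨i, rfl⟩ := hz
    exact hA.exists_eigenvector i
  finiteDimensional z _ := hA.finiteDimensional_rootSpace (finite_fiber hl z)
  finite_inter_closedBall r := by
    refine ((finite_norm_le hl r).image l).subset ?_
    rintro z ⟨hz, hr⟩
    rw [hA.spec_eq hl] at hz
    obtain ⟨i, rfl⟩ := hz
    exact ⟨i, by simpa using hr, rfl⟩

/-- The sum over indices is regrouped along the finite fibres of `l`, whose cardinalities are the
algebraic multiplicities. -/
theorem hasSum_spec (hA : IsTriangular A b i₀ l w)
    (hl : Filter.Tendsto (fun i => ‖l i‖) Filter.cofinite Filter.atTop) {F : ℂ → ℂ} {a : ℂ}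
    (h : HasSum (fun i => F (l i)) a) :
    HasSum (fun z : spec A => (algMult A z : ℂ) * F z) a := by
  let p : ι → spec A := fun i => ⟨l i, hA.spec_eq hl ▸ mem_range_self i⟩
  have h1 := (Equiv.sigmaFiberEquiv p).hasSum_iff.2 h
  refine h1.sigma fun z => ?_
  have hf : {i | p i = z}.Finite :=
    (finite_fiber hl (z : ℂ)).subset fun i (hi : p i = z) => congrArg Subtype.val hi
  have e : {i | l i = z} = {i | p i = z} := by
    ext i
    exact ⟨fun h => Subtype.ext h, congrArg Subtype.val⟩
  have : Fintype {i | p i = z} := hf.fintype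
  have h2 : ∀ i : {i | p i = z}, F (l i) = F z := fun i => by
    have : p i = z := i.2
    exact congrArg F (congrArg Subtype.val this)
  have h3 := hasSum_fintype fun i : {i | p i = z} => F (l i)
  simp only [h2, Finset.sum_const, Finset.card_univ, nsmul_eq_mul] at h3
  rw [hA.algMult_eq (finite_fiber hl z), e, ← Nat.card_coe_set_eq, Nat.card_eq_fintype_card]
  convert! h3 using 1
  ext i
  exact h2 i

end IsTriangular

end UnboundedOperator
-- The Fourier basis for the arc-length measure
namespace FaddeevPopov

open scoped ComplexConjugate InnerProductSpace
open UnboundedOperator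

variable {T : ℝ}

theorem contDiff_fourier (n : ℤ) :
    ContDiff ℝ (⊤ : ℕ∞) fun τ : ℝ => fourier n (τ : AddCircle T) := by
  have ho : ContDiff ℝ (⊤ : ℕ∞) (fun τ : ℝ => (τ : ℂ)) := Complex.ofRealCLM.contDiff
  simp only [fourier_coe_apply]
  exact ((contDiff_const.mul ho).div_const _).cexp

theorem periodic_fourier (n : ℤ) :
    Function.Periodic (fun τ : ℝ => fourier n (τ : AddCircle T)) T := fun τ => by
  simp only [AddCircle.coe_add_period]

theorem iteratedDeriv_two_fourier (n : ℤ) (τ : ℝ) :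
    iteratedDeriv 2 (fun τ : ℝ => fourier n (τ : AddCircle T)) τ =
      -(2 * Real.pi * n / T : ℂ) ^ 2 * fourier n (τ : AddCircle T) := by
  have h : deriv (fun τ : ℝ => fourier n (τ : AddCircle T)) =
      fun τ : ℝ => (2 * Real.pi * Complex.I * n / T : ℂ) * fourier n (τ : AddCircle T) :=
    funext fun τ => (hasDerivAt_fourier T n τ).deriv
  rw [iteratedDeriv_succ, iteratedDeriv_one, h,
    ((hasDerivAt_fourier T n τ).const_mul _).deriv, ← mul_assoc]
  congr 1
  linear_combination (2 * Real.pi * n / T : ℂ) ^ 2 * Complex.I_sq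

theorem periodic_deriv {φ : ℝ → ℂ} (hφ : Function.Periodic φ T) :
    Function.Periodic (deriv φ) T := fun τ => by
  rw [← deriv_comp_add_const]
  congr 1
  exact funext hφ

/-- Integration by parts; periodicity cancels the boundary terms. -/
theorem intervalIntegral_mul_deriv {u v : ℝ → ℂ} (hu : ContDiff ℝ (⊤ : ℕ∞) u)
    (hv : ContDiff ℝ (⊤ : ℕ∞) v) (hpu : Function.Periodic u T) (hpv : Function.Periodic v T) :
    ∫ τ in (0 : ℝ)..T, u τ * deriv v τ = -∫ τ in (0 : ℝ)..T, deriv u τ * v τ := by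
  have hne : ((⊤ : ℕ∞) : WithTop ℕ∞) ≠ 0 := by simp
  have h1 : (1 : WithTop ℕ∞) ≤ ((⊤ : ℕ∞) : WithTop ℕ∞) := by exact_mod_cast le_top
  rw [intervalIntegral.integral_mul_deriv_eq_deriv_mul
    (fun x _ => (hu.differentiable hne x).hasDerivAt)
    (fun x _ => (hv.differentiable hne x).hasDerivAt)
    ((hu.continuous_deriv h1).intervalIntegrable _ _)
    ((hv.continuous_deriv h1).intervalIntegrable _ _)]
  have e1 := hpu 0
  have e2 := hpv 0
  rw [zero_add] at e1 e2
  rw [e1, e2, sub_self, zero_sub]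

theorem contDiff_deriv {φ : ℝ → ℂ} (hφ : ContDiff ℝ (⊤ : ℕ∞) φ) :
    ContDiff ℝ (⊤ : ℕ∞) (deriv φ) :=
  (contDiff_infty_iff_deriv.1 hφ).2

theorem intervalIntegral_fourier_mul_iteratedDeriv {φ : ℝ → ℂ} (hφ : ContDiff ℝ (⊤ : ℕ∞) φ)
    (hp : Function.Periodic φ T) (n : ℤ) :
    ∫ τ in (0 : ℝ)..T, fourier n (τ : AddCircle T) * iteratedDeriv 2 φ τ =
      -(2 * Real.pi * n / T : ℂ) ^ 2 * ∫ τ in (0 : ℝ)..T, fourier n (τ : AddCircle T) * φ τ := by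
  have hf := contDiff_fourier (T := T) n
  have hpf := periodic_fourier (T := T) n
  rw [iteratedDeriv_succ, iteratedDeriv_one,
    intervalIntegral_mul_deriv hf (contDiff_deriv hφ) hpf (periodic_deriv hp),
    intervalIntegral_mul_deriv (contDiff_deriv hf) hφ (periodic_deriv hpf) hp, neg_neg,
    ← intervalIntegral.integral_const_mul]
  congr 1
  funext τ
  rw [← iteratedDeriv_one (f := fun τ : ℝ => fourier n (τ : AddCircle T)), ← iteratedDeriv_succ,
    iteratedDeriv_two_fourier, mul_assoc]

variable [hT : Fact (0 < T)]

theorem inner_eq_intervalIntegral {u : L2 T} {U : AddCircle T → ℂ} (hu : u =ᵐ[volume] U)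
    (f : L2 T) : ⟪u, f⟫_ℂ = ∫ τ in (0 : ℝ)..T, f (τ : AddCircle T) * conj (U τ) := by
  have h := AddCircle.intervalIntegral_preimage T 0 fun τ => f τ * conj (U τ)
  rw [zero_add] at h
  rw [h, L2.inner_def]
  refine integral_congr_ae ?_
  filter_upwards [hu] with τ hτ
  rw [RCLike.inner_apply, hτ]

/-- The normalized Fourier monomials in `L²(S¹)` with the arc-length measure. -/
def fourierVec (n : ℤ) : L2 T :=
  ((√T : ℝ) : ℂ)⁻¹ • ContinuousMap.toLp 2 volume ℂ (fourier n)

theorem sqrt_ne_zero : ((√T : ℝ) : ℂ) ≠ 0 :=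
  Complex.ofReal_ne_zero.2 (Real.sqrt_pos.2 hT.out).ne'

/-- Orthonormality for the Haar probability measure, rescaled by the total arc length `T`. -/
theorem inner_toLp_fourier (i j : ℤ) :
    ⟪ContinuousMap.toLp (E := ℂ) 2 (volume : Measure (AddCircle T)) ℂ (fourier i),
      ContinuousMap.toLp (E := ℂ) 2 volume ℂ (fourier j)⟫_ℂ = if i = j then (T : ℂ) else 0 := by
  have h := orthonormal_iff_ite.1 (orthonormal_fourier (T := T)) i j
  rw [fourierLp, fourierLp, ContinuousMap.inner_toLp, AddCircle.integral_haarAddCircle] at h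
  rw [ContinuousMap.inner_toLp]
  have hT' := hT.out.ne'
  rw [inv_smul_eq_iff₀ hT'] at h
  rw [h]
  split_ifs <;> simp

theorem orthonormal_fourierVec : Orthonormal ℂ (fourierVec (T := T)) := by
  rw [orthonormal_iff_ite]
  intro i j
  rw [fourierVec, fourierVec, inner_smul_left, inner_smul_right, inner_toLp_fourier]
  split_ifs
  · rw [map_inv₀, Complex.conj_ofReal, ← mul_assoc, ← mul_inv, ← Complex.ofReal_mul,
      Real.mul_self_sqrt hT.out.le, inv_mul_cancel₀ (Complex.ofReal_ne_zero.2 hT.out.ne')]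
  · simp

theorem inner_fourierVec (n : ℤ) (f : L2 T) : ⟪fourierVec n, f⟫_ℂ =
    ((√T : ℝ) : ℂ)⁻¹ * ∫ τ in (0 : ℝ)..T, f (τ : AddCircle T) * fourier (-n) (τ : AddCircle T) := by
  rw [fourierVec, inner_smul_left, map_inv₀, Complex.conj_ofReal,
    inner_eq_intervalIntegral (ContinuousMap.coeFn_toLp volume (fourier n))]
  simp only [fourier_neg]

/-- Completeness carries over from `fourierBasis`, since arc length is `T` times the Haar
probability measure. -/
theorem eq_zero_of_inner_fourierVec (f : L2 T) (hf : ∀ n, ⟪fourierVec n, f⟫_ℂ = 0) : f = 0 := by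
  have hm : MemLp (f : AddCircle T → ℂ) 2 AddCircle.haarAddCircle :=
    memLp_haarAddCircle_iff.2 (Lp.memLp f)
  have key : hm.toLp f = 0 := by
    apply fourierBasis.repr.injective
    rw [map_zero]
    ext n
    rw [fourierBasis_repr, fourierCoeff_congr_ae hm.coeFn_toLp,
      fourierCoeff_eq_intervalIntegral _ n 0, zero_add]
    have h := hf n
    rw [inner_fourierVec] at h
    have h1 := (mul_eq_zero.1 h).resolve_left (inv_ne_zero sqrt_ne_zero)
    simp only [smul_eq_mul, mul_comm _ (f _), h1]
    simp
  have h2 : (f : AddCircle T → ℂ) =ᵐ[AddCircle.haarAddCircle] 0 := by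
    have := hm.coeFn_toLp
    rw [key] at this
    exact this.symm.trans (Lp.coeFn_zero _ _ _)
  rw [Lp.eq_zero_iff_ae_eq_zero]
  exact Measure.ae_smul_measure h2 (ENNReal.ofReal T)

variable (T) in
/-- The Hilbert basis of `L²(S¹)` that consists of the normalized Fourier monomials. -/
def circleBasis : HilbertBasis ℤ ℂ (L2 T) :=
  HilbertBasis.mkOfOrthogonalEqBot orthonormal_fourierVec <| by
    rw [Submodule.eq_bot_iff]
    intro f hf
    refine eq_zero_of_inner_fourierVec f fun n => ?_
    exact (Submodule.mem_orthogonal _ _).1 hf _ (Submodule.subset_span (mem_range_self n))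

theorem circleBasis_apply (n : ℤ) : circleBasis T n = fourierVec n := by
  rw [circleBasis, HilbertBasis.coe_mkOfOrthogonalEqBot]

theorem circleBasis_repr (f : L2 T) (n : ℤ) : (circleBasis T).repr f n =
    ((√T : ℝ) : ℂ)⁻¹ * ∫ τ in (0 : ℝ)..T, f (τ : AddCircle T) * fourier (-n) (τ : AddCircle T) := by
  rw [HilbertBasis.repr_apply_apply, circleBasis_apply, inner_fourierVec]

/-! ### The weak second derivative in Fourier coordinates -/

/-- A continuous periodic function has a conjugate in `L²(S¹)`. -/
theorem exists_conj {φ : ℝ → ℂ} (hφ : Continuous φ) (hp : Function.Periodic φ T) :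
    ∃ u : L2 T, ∀ f : L2 T, ⟪u, f⟫_ℂ = ∫ τ in (0 : ℝ)..T, f (τ : AddCircle T) * φ τ := by
  let U : C(AddCircle T, ℂ) := ⟨fun τ => conj (hp.lift τ),
    Complex.continuous_conj.comp (continuous_coinduced_dom.2 hφ)⟩
  refine ⟨ContinuousMap.toLp 2 volume ℂ U, fun f => ?_⟩
  rw [inner_eq_intervalIntegral (ContinuousMap.coeFn_toLp volume U)]
  congr 1
  funext τ
  simp [U]

/-- Parseval's identity, with the bilinear pairing against `φ` written as an inner product with its
conjugate. -/
theorem hasSum_intervalIntegral_mul {φ : ℝ → ℂ} (hφ : Continuous φ) (hp : Function.Periodic φ T)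
    (f : L2 T) : HasSum (fun n : ℤ => ((√T : ℝ) : ℂ)⁻¹ *
      (∫ τ in (0 : ℝ)..T, fourier n (τ : AddCircle T) * φ τ) * (circleBasis T).repr f n)
      (∫ τ in (0 : ℝ)..T, f (τ : AddCircle T) * φ τ) := by
  obtain ⟨u, hu⟩ := exists_conj hφ hp
  have h := (circleBasis T).hasSum_inner_mul_inner u f
  rw [hu f] at h
  convert! h using 1
  funext n
  rw [HilbertBasis.repr_apply_apply, circleBasis_apply, fourierVec, inner_smul_right, hu,
    intervalIntegral_congr_ae (ContinuousMap.coeFn_toLp volume (fourier n))]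

/-- Testing against `fourier (-n)` gives the coordinates of `h`. Conversely, Parseval expands both
pairings, and two integrations by parts match them term by term. Thus the domain of the weak
derivative is the maximal one in Fourier coordinates. -/
theorem isWeakSecondDeriv_iff {f h : L2 T} : IsWeakSecondDeriv f h ↔
    ∀ n : ℤ, (circleBasis T).repr h n =
      -(2 * Real.pi * n / T : ℂ) ^ 2 * (circleBasis T).repr f n := by
  constructor
  · intro H n
    rw [circleBasis_repr, circleBasis_repr, ← H _ (contDiff_fourier (-n)) (periodic_fourier (-n)),
      mul_left_comm (-(2 * Real.pi * n / T : ℂ) ^ 2),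
      ← intervalIntegral.integral_const_mul (-(2 * Real.pi * n / T : ℂ) ^ 2)]
    congr 2
    funext τ
    rw [iteratedDeriv_two_fourier]
    push_cast
    ring
  · intro H φ hφ hp
    have hc : Continuous (iteratedDeriv 2 φ) :=
      (contDiff_infty.1 hφ 2).continuous_iteratedDeriv 2 le_rfl
    have hp2 : Function.Periodic (iteratedDeriv 2 φ) T := by
      rw [iteratedDeriv_succ, iteratedDeriv_one]
      exact periodic_deriv (periodic_deriv hp)
    refine (hasSum_intervalIntegral_mul hc hp2 f).unique ?_
    convert! hasSum_intervalIntegral_mul hφ.continuous hp h using 1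
    funext n
    rw [intervalIntegral_fourier_mul_iteratedDeriv hφ hp, H]
    ring

/-! ### The Faddeev–Popov operator in Fourier coordinates -/

theorem const_eq_smul_circleBasis (c : ℂ) :
    Lp.const 2 (volume : Measure (AddCircle T)) c = (((√T : ℝ) : ℂ) * c) • circleBasis T 0 := by
  rw [circleBasis_apply, fourierVec, smul_smul, mul_right_comm, mul_inv_cancel₀ sqrt_ne_zero,
    one_mul]
  refine Lp.ext ?_
  filter_upwards [Lp.coeFn_const 2 (volume : Measure (AddCircle T)) c,
    Lp.coeFn_smul c (ContinuousMap.toLp 2 (volume : Measure (AddCircle T)) ℂ (fourier 0)),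
    ContinuousMap.coeFn_toLp (p := 2) (𝕜 := ℂ) (volume : Measure (AddCircle T))
      (fourier 0)] with τ h1 h2 h3
  rw [h1, h2, Pi.smul_apply, h3, fourier_zero]
  simp

/-- The coordinate at the constants of the nonlocal term, as a bounded functional. -/
def nonlocalFunctional (γ : ℝ) (k g : AddCircle T → ℝ)
    (hkg : MemLp (fun τ => k τ * g τ) 2 volume) : L2 T →L[ℂ] ℂ :=
  (((√T : ℝ) : ℂ) * γ) • innerSL ℂ ((hkg.ofReal (K := ℂ)).toLp)

theorem nonlocalTerm_eq (γ : ℝ) (k g : AddCircle T → ℝ)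
    (hkg : MemLp (fun τ => k τ * g τ) 2 volume) (f : L2 T) :
    nonlocalTerm γ k g hkg f = nonlocalFunctional γ k g hkg f • circleBasis T 0 := by
  change Lp.const 2 volume ((γ : ℂ) * ∫ τ, (k τ : ℂ) * g τ * f τ) = _
  rw [const_eq_smul_circleBasis, nonlocalFunctional, smul_apply,
    innerSL_apply_apply, smul_eq_mul, mul_assoc, L2.inner_def]
  congr 3
  refine integral_congr_ae ?_
  filter_upwards [(hkg.ofReal (K := ℂ)).coeFn_toLp] with τ hτ
  rw [RCLike.inner_apply, hτ]
  simp [mul_comm]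

theorem nonlocalFunctional_circleBasis (β γ : ℝ) (k g : AddCircle T → ℝ)
    (hkg : MemLp (fun τ => k τ * g τ) 2 volume) :
    nonlocalFunctional γ k g hkg (circleBasis T 0) = (eigenvalue T β γ k g 0 : ℂ) := by
  rw [nonlocalFunctional, smul_apply, innerSL_apply_apply, circleBasis_apply,
    fourierVec, inner_smul_right, smul_eq_mul, L2.inner_def, eigenvalue, if_pos rfl,
    Complex.ofReal_mul, ← integral_complex_ofReal]
  have : ∫ τ, ⟪((hkg.ofReal (K := ℂ)).toLp : L2 T) τ,
      (ContinuousMap.toLp 2 volume ℂ (fourier 0) : L2 T) τ⟫_ℂ = ∫ τ, ((k τ * g τ : ℝ) : ℂ) := by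
    refine integral_congr_ae ?_
    filter_upwards [(hkg.ofReal (K := ℂ)).coeFn_toLp,
      ContinuousMap.coeFn_toLp (p := 2) (𝕜 := ℂ) (volume : Measure (AddCircle T))
        (fourier 0)] with τ h1 h2
    rw [RCLike.inner_apply, h1, h2, fourier_zero]
    simp
  rw [this]
  have := sqrt_ne_zero (T := T)
  field_simp

/-- Uniqueness of the weak second derivative removes the choice made in `secondDeriv`. -/
theorem mem_graph_faddeevPopov {β γ : ℝ} {k g : AddCircle T → ℝ}
    {hkg : MemLp (fun τ => k τ * g τ) 2 volume} {x y : L2 T} :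
    (x, y) ∈ (faddeevPopov β γ k g hkg).graph ↔
      ∃ h, IsWeakSecondDeriv x h ∧ y = -(β : ℂ) • h + nonlocalTerm γ k g hkg x := by
  rw [LinearPMap.mem_graph_iff]
  constructor
  · rintro ⟨u, rfl, rfl⟩
    exact ⟨_, secondDeriv_spec u, rfl⟩
  · rintro ⟨h, hx, rfl⟩
    let u : (secondDeriv T).domain := ⟨x, h, hx⟩
    refine ⟨u, rfl, ?_⟩
    rw [hx.unique (secondDeriv_spec u)]
    rfl

theorem isTriangular_faddeevPopov {β γ : ℝ} (hβ : β ≠ 0) (k g : AddCircle T → ℝ)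
    (hkg : MemLp (fun τ => k τ * g τ) 2 volume) :
    IsTriangular (faddeevPopov β γ k g hkg) (circleBasis T) 0
      (fun n => (eigenvalue T β γ k g n : ℂ)) (nonlocalFunctional γ k g hkg) where
  apply_basis := nonlocalFunctional_circleBasis β γ k g hkg
  mem_graph_iff x y := by
    have hβ' : (β : ℂ) ≠ 0 := Complex.ofReal_ne_zero.2 hβ
    rw [mem_graph_faddeevPopov, nonlocalTerm_eq]
    constructor
    · rintro ⟨h, hx, rfl⟩
      rw [isWeakSecondDeriv_iff] at hx
      refine ⟨fun n hn => ?_, ?_⟩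
      · rw [repr_add, repr_smul, repr_smul, repr_basis, if_neg hn, hx, eigenvalue, if_neg hn]
        push_cast
        ring
      · rw [repr_add, repr_smul, repr_smul, repr_basis, if_pos rfl, hx]
        simp
    · rintro ⟨hy, hy₀⟩
      -- The candidate for the second derivative is obtained by solving `y = -β h + w(x) b₀` for
      -- `h`; its zeroth coordinate vanishes by `hy₀`.
      refine ⟨(-(β : ℂ)⁻¹) • (y - nonlocalFunctional γ k g hkg x • circleBasis T 0),
        isWeakSecondDeriv_iff.2 fun n => ?_, ?_⟩
      · rw [repr_smul, repr_sub, repr_smul, repr_basis]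
        by_cases hn : n = 0
        · subst hn
          rw [hy₀]
          simp
        · rw [hy n hn, eigenvalue, if_neg hn, if_neg hn]
          push_cast
          field_simp
          ring
      · rw [smul_smul, neg_mul_neg, mul_inv_cancel₀ hβ', one_smul, sub_add_cancel]

theorem tendsto_norm_eigenvalue {β : ℝ} (hβ : β ≠ 0) (γ : ℝ) (k g : AddCircle T → ℝ) :
    Filter.Tendsto (fun n => ‖(eigenvalue T β γ k g n : ℂ)‖) Filter.cofinite Filter.atTop := by
  have h1 : Filter.Tendsto (fun n : ℤ => ‖(n : ℝ)‖) Filter.cofinite Filter.atTop := by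
    have := tendsto_norm_cocompact_atTop (E := ℝ) |>.comp Int.tendsto_coe_cofinite
    exact this
  have h2 : Filter.Tendsto (fun n : ℤ => |β| * (2 * Real.pi / T) ^ 2 * ‖(n : ℝ)‖ ^ 2)
      Filter.cofinite Filter.atTop := by
    have hT' := hT.out
    refine Filter.Tendsto.const_mul_atTop (by positivity) ?_
    exact (Filter.tendsto_pow_atTop two_ne_zero).comp h1
  refine h2.congr' ?_
  filter_upwards [(finite_singleton (0 : ℤ)).compl_mem_cofinite] with n hn
  have hn' : n ≠ 0 := hn
  rw [eigenvalue, if_neg hn', Complex.norm_real, norm_mul, Real.norm_eq_abs β, norm_pow,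
    norm_div, norm_mul, Real.norm_of_nonneg (by positivity : (0 : ℝ) ≤ 2 * Real.pi),
    Real.norm_of_nonneg hT.out.le]
  ring

end FaddeevPopov
-- The zeta function and its derivative at zero
namespace FaddeevPopov

/-- The meromorphic continuation of `a ^ (-s) + ∑ (c * n ^ 2) ^ (-s)`, the sum being over the
nonzero integers `n`. -/
def circleZeta (a c s : ℂ) : ℂ := a ^ (-s) + 2 * c ^ (-s) * riemannZeta (2 * s)

theorem differentiable_cpow_neg {c : ℂ} (hc : c ≠ 0) : Differentiable ℂ fun s : ℂ => c ^ (-s) :=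
  fun s => ((hasDerivAt_neg s).const_cpow (.inl hc)).differentiableAt

theorem meromorphicOn_circleZeta {a c : ℂ} (ha : a ≠ 0) (hc : c ≠ 0) :
    MeromorphicOn (circleZeta a c) univ := by
  intro s _
  have h1 : MeromorphicAt (fun s : ℂ => a ^ (-s)) s :=
    ((differentiable_cpow_neg ha).analyticAt s).meromorphicAt
  have h2 : MeromorphicAt (fun s : ℂ => 2 * c ^ (-s)) s :=
    (((differentiable_cpow_neg hc).const_mul 2).analyticAt s).meromorphicAt
  have h3 : MeromorphicAt riemannZeta (2 * s) := by
    -- Dividing the entire function `riemannZeta₁` by `z - 1` gives zeta away from 1, and the value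
    -- at 1 itself is irrelevant on a punctured neighbourhood.
    have h : MeromorphicAt (fun z : ℂ => (z - 1)⁻¹ * riemannZeta₁ z) (2 * s) :=
      ((MeromorphicAt.id _).sub (MeromorphicAt.const 1 _)).inv.mul
        (differentiable_riemannZeta₁.analyticAt _).meromorphicAt
    refine h.congr ?_
    have hne : ∀ᶠ z in nhdsWithin (2 * s) {2 * s}ᶜ, z ≠ 1 := by
      by_cases h1 : 2 * s = 1
      · rw [h1]
        exact eventually_mem_nhdsWithin
      · exact (eventually_ne_nhds h1).filter_mono nhdsWithin_le_nhds
    filter_upwards [hne] with z hz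
    exact (riemannZeta_eq_inv_sub_mul hz).symm
  have h4 : AnalyticAt ℂ (fun s : ℂ => 2 * s) s := by fun_prop
  exact h1.add (h2.mul (h3.comp_analyticAt h4))

theorem hasDerivAt_circleZeta_zero {a c : ℂ} (ha : a ≠ 0) (hc : c ≠ 0) :
    HasDerivAt (circleZeta a c)
      (-Complex.log a + Complex.log c - 2 * Complex.log (2 * Real.pi)) 0 := by
  have h1 : HasDerivAt (fun s : ℂ => a ^ (-s)) (-Complex.log a) 0 := by
    simpa using (hasDerivAt_neg (0 : ℂ)).const_cpow (c := a) (.inl ha)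
  have h2 : HasDerivAt (fun s : ℂ => 2 * c ^ (-s)) (-(2 * Complex.log c)) 0 := by
    simpa using ((hasDerivAt_neg (0 : ℂ)).const_cpow (c := c) (.inl hc)).const_mul 2
  have h3 : HasDerivAt riemannZeta (-Complex.log (2 * Real.pi) / 2) (2 * 0) := by
    rw [mul_zero, ← deriv_riemannZeta_zero]
    exact (differentiableAt_riemannZeta zero_ne_one).hasDerivAt
  have h4 : HasDerivAt (fun s : ℂ => 2 * s) 2 0 := by
    simpa using (hasDerivAt_id (0 : ℂ)).const_mul 2
  have h5 := h1.add (h2.mul (h3.comp 0 h4))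
  refine h5.congr_deriv ?_
  simp [riemannZeta_zero]
  ring

theorem analyticAt_circleZeta_zero {a c : ℂ} (ha : a ≠ 0) (hc : c ≠ 0) :
    AnalyticAt ℂ (circleZeta a c) 0 := by
  have ho : IsOpen {s : ℂ | 2 * s ≠ 1} := isOpen_ne_fun (by fun_prop) continuous_const
  refine DifferentiableOn.analyticAt (s := {s : ℂ | 2 * s ≠ 1}) (fun s hs => ?_)
    (ho.mem_nhds (by simp))
  refine DifferentiableAt.differentiableWithinAt ?_
  have h4 : DifferentiableAt ℂ (fun s : ℂ => 2 * s) s := by fun_prop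
  exact (differentiable_cpow_neg ha s).add (((differentiable_cpow_neg hc s).const_mul 2).mul
    (DifferentiableAt.comp (g := riemannZeta) s (differentiableAt_riemannZeta hs) h4))

/-- The derivative is a combination of logarithms with integer coefficients, so the exponential
removes any dependence on the branch. -/
theorem exp_neg_deriv_circleZeta {a c : ℂ} (ha : a ≠ 0) (hc : c ≠ 0) :
    Complex.exp (-deriv (circleZeta a c) 0) = a / c * (2 * Real.pi) ^ 2 := by
  have hpi : (2 * Real.pi : ℂ) ≠ 0 := by simp [Real.pi_ne_zero]
  rw [(hasDerivAt_circleZeta_zero ha hc).deriv, show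
    -(-Complex.log a + Complex.log c - 2 * Complex.log (2 * Real.pi)) =
      Complex.log a - Complex.log c + (2 : ℕ) * Complex.log (2 * Real.pi) by push_cast; ring,
    Complex.exp_add, Complex.exp_sub, Complex.exp_nat_mul, Complex.exp_log ha, Complex.exp_log hc,
    Complex.exp_log hpi]

/-- A positive factor does not change the argument, so the principal logarithm is additive here even
for negative `c`. -/
theorem mul_sq_cpow_neg {c : ℂ} (hc : c ≠ 0) {m : ℝ} (hm : 0 < m) (s : ℂ) :
    (c * (m : ℂ) ^ 2) ^ (-s) = c ^ (-s) * (1 / (m : ℂ) ^ (2 * s)) := by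
  have hm' : (m : ℂ) ≠ 0 := Complex.ofReal_ne_zero.2 hm.ne'
  have hl : Complex.log (c * (m : ℂ) ^ 2) = 2 * Complex.log m + Complex.log c := by
    rw [mul_comm, ← Complex.ofReal_pow, Complex.log_ofReal_mul (by positivity) hc, Real.log_pow,
      ← Complex.ofReal_log hm.le]
    push_cast
    rfl
  rw [one_div, ← Complex.cpow_neg, Complex.cpow_def_of_ne_zero (mul_ne_zero hc (pow_ne_zero 2 hm')),
    Complex.cpow_def_of_ne_zero hc, Complex.cpow_def_of_ne_zero hm', hl, ← Complex.exp_add]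
  congr 1
  ring

theorem hasSum_riemannZeta {s : ℂ} (hs : 1 < s.re) :
    HasSum (fun n : ℕ => 1 / (((n + 1 : ℝ) : ℂ)) ^ s) (riemannZeta s) := by
  have h := (summable_nat_add_iff 1).2 (Complex.summable_one_div_nat_cpow.2 hs)
  rw [zeta_eq_tsum_one_div_nat_add_one_cpow hs]
  simpa using h.hasSum

/-- The positive and the negative integers each contribute `c^(-s) ζ(2s)`; the index 0 contributes
`a^(-s)`. -/
theorem hasSum_circleZeta {a c : ℂ} (hc : c ≠ 0) {l : ℤ → ℂ} (h₀ : l 0 = a)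
    (hl : ∀ n : ℤ, n ≠ 0 → l n = c * (n : ℂ) ^ 2) {s : ℂ} (hs : 1 / 2 < s.re) :
    HasSum (fun n => l n ^ (-s)) (circleZeta a c s) := by
  have h2 : 1 < (2 * s).re := by
    simp only [Complex.mul_re, Complex.re_ofNat, Complex.im_ofNat]
    linarith
  have h := (hasSum_riemannZeta h2).mul_left (c ^ (-s))
  have hpos (n : ℕ) : (0 : ℝ) < n + 1 := by positivity
  have e1 (n : ℕ) : l ((n + 1 : ℕ) : ℤ) ^ (-s) =
      c ^ (-s) * (1 / ((n + 1 : ℝ) : ℂ) ^ (2 * s)) := by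
    rw [← mul_sq_cpow_neg hc (hpos n), hl _ (by omega)]
    push_cast
    rfl
  have e2 (n : ℕ) : l (-(n + 1)) ^ (-s) = c ^ (-s) * (1 / ((n + 1 : ℝ) : ℂ) ^ (2 * s)) := by
    rw [← mul_sq_cpow_neg hc (hpos n), hl _ (by omega)]
    push_cast
    rw [neg_sq]
  -- Shifting the index by one restores the term at `n = 0`.
  have h3 : HasSum (fun n : ℕ => l (n : ℤ) ^ (-s)) (c ^ (-s) * riemannZeta (2 * s) + a ^ (-s)) := by
    have := (hasSum_nat_add_iff (f := fun n : ℕ => l (n : ℤ) ^ (-s)) 1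
      (g := c ^ (-s) * riemannZeta (2 * s))).1 (by simpa only [e1] using h)
    simpa [h₀] using this
  have h4 : HasSum (fun n : ℕ => l (-(n + 1)) ^ (-s)) (c ^ (-s) * riemannZeta (2 * s)) := by
    simpa only [e2] using h
  have h5 := HasSum.of_nat_of_neg_add_one (f := fun n => l n ^ (-s)) h3 h4
  convert! h5 using 1
  rw [circleZeta]
  ring

open UnboundedOperator in
/-- The zeta-regularized determinant of a triangular operator with the diagonal entries `c * n ^ 2`
for `n ≠ 0`. -/
theorem isZetaDet_of_isTriangular {H : Type*} [NormedAddCommGroup H] [InnerProductSpace ℂ H]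
    {A : H →ₗ.[ℂ] H} {b : HilbertBasis ℤ ℂ H} {l : ℤ → ℂ} {w : H →L[ℂ] ℂ}
    (hA : IsTriangular A b 0 l w)
    (hlim : Filter.Tendsto (fun i => ‖l i‖) Filter.cofinite Filter.atTop)
    {c : ℂ} (hc : c ≠ 0) (h₀ : l 0 ≠ 0) (hl : ∀ n : ℤ, n ≠ 0 → l n = c * (n : ℂ) ^ 2) :
    IsZetaDet A (l 0 / c * (2 * Real.pi) ^ 2) := by
  refine ⟨hA.hasDiscreteSpectrum hlim, ?_, circleZeta (l 0) c,
    ⟨⟨1 / 2, fun s hs => hA.hasSum_spec hlim (F := fun z => z ^ (-s))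
      (hasSum_circleZeta hc rfl hl hs)⟩, meromorphicOn_circleZeta h₀ hc⟩,
    analyticAt_circleZeta_zero h₀ hc, (exp_neg_deriv_circleZeta h₀ hc).symm⟩
  rw [hA.spec_eq hlim]
  rintro ⟨n, hn⟩
  by_cases h : n = 0
  · exact h₀ (h ▸ hn)
  · change l n = 0 at hn
    rw [hl n h] at hn
    exact mul_ne_zero hc (pow_ne_zero 2 (Int.cast_ne_zero.2 h)) hn

end FaddeevPopov

end

theorem mainTheorem2 (T : ℝ) [Fact (0 < T)] (β γ : ℝ) (k g : AddCircle T → ℝ)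
    (hkg : MemLp (fun τ => k τ * g τ) 2 volume)
    (hβ : β ≠ 0) (hγ : γ * (∫ τ, k τ * g τ) ≠ 0) :
    UnboundedOperator.spec (FaddeevPopov.faddeevPopov β γ k g hkg) =
        range (fun n : ℤ => (FaddeevPopov.eigenvalue T β γ k g n : ℂ)) ∧
      (∀ z : ℂ, UnboundedOperator.algMult (FaddeevPopov.faddeevPopov β γ k g hkg) z =
        {n : ℤ | (FaddeevPopov.eigenvalue T β γ k g n : ℂ) = z}.ncard) ∧
      UnboundedOperator.IsZetaDet (FaddeevPopov.faddeevPopov β γ k g hkg)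
        ((γ / β * T ^ 2 * (∫ τ, k τ * g τ) : ℝ) : ℂ) := by
  have hA := FaddeevPopov.isTriangular_faddeevPopov (γ := γ) hβ k g hkg
  have hlim := FaddeevPopov.tendsto_norm_eigenvalue hβ γ k g
  refine ⟨hA.spec_eq hlim, fun z =>
    hA.algMult_eq (UnboundedOperator.IsTriangular.finite_fiber hlim z), ?_⟩
  have hT : T ≠ 0 := (Fact.out : 0 < T).ne'
  have hpi := Real.pi_ne_zero
  -- This is the constant `c` in `λₙ = c n²`; its factor `(2π)²` later cancels the one produced by
  -- `ζ'(0)`.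
  have hc : ((β * (2 * Real.pi / T) ^ 2 : ℝ) : ℂ) ≠ 0 :=
    Complex.ofReal_ne_zero.2 (by positivity)
  have h₀ : FaddeevPopov.eigenvalue T β γ k g 0 = γ * ∫ τ, k τ * g τ := if_pos rfl
  have h := FaddeevPopov.isZetaDet_of_isTriangular hA hlim hc
    (Complex.ofReal_ne_zero.2 (h₀ ▸ hγ)) fun n hn => by
      rw [FaddeevPopov.eigenvalue, if_neg hn]
      push_cast
      ring
  convert! h using 1
  rw [h₀]
  norm_cast
  field_simp
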